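/- Let $K \subset \mathbb{R}^2$ be a symmetric convex body, that is, a compact convex set with nonempty interior such that $K = -K$, and suppose that $K$ has area $|K| = 1$. Let $N \ge 2$ be an integer, let $x_1, \dots, x_N$ be independent random points distributed uniformly in $K$, and put $$V_{K,N} = \frac{\mathrm{vol}_2\big(\mathrm{conv}\{\pm x_1, \dots, \pm x_N\}\big)}{\mathrm{vol}_2(K)}.$$ For $r \ge 0$ and $\theta \in \mathbb{R}$ let $$\ell(r,\theta) = \mathrm{vol}_1\big(\{(x,y) : (x,y)\cdot(\cos\theta,\sin\theta) = r\} \cap K\big), \qquad A(r,\theta) = \mathrm{vol}_2\big(\{(x,y) : |(x,y)\cdot(\cos\theta,\sin\theta)| \le r\} \cap K\big),$$ where $\mathrm{vol}_1$ is length and $\mathrm{vol}_2$ is area. Then $V_{K,N}$ is integrable, the function $(\theta,r) \mapsto A(r,\theta)^{N-1}\ell(r,\theta)^3$ is integrable on $(0,2\pi]\times(0,\infty)$, and $$\mathbb{E}\, V_{K,N} = 1 - \frac{N}{3} \int_0^{2\pi} \int_0^\infty A(r,\theta)^{N-1}\, \ell(r,\theta)^3 \, dr\, d\theta.$$ -/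

import Mathlib

noncomputable section

/-- Symmetric convex bodies: compact convex sets with interior points such that `K = -K`. -/
structure IsSymmConvexBody {n : ℕ} (K : Set (EuclideanSpace ℝ (Fin n))) : Prop where
  isCompact : IsCompact K
  convex : Convex ℝ K
  interior_nonempty : (interior K).Nonempty
  eq_neg : K = -K

/-- `vol_n (conv {± x₁, …, ± x_N}) / vol_n K`. -/
def symHullVolRatio {n N : ℕ} (K : Set (EuclideanSpace ℝ (Fin n)))
    (x : Fin N → EuclideanSpace ℝ (Fin n)) : ℝ :=
  (MeasureTheory.volume
      (convexHull ℝ (Set.range (fun i => x i) ∪ Set.range (fun i => -x i)))).toReal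
    / (MeasureTheory.volume K).toReal

/-- The unit vector `(cos θ, sin θ)`. -/
def dirVec (θ : ℝ) : EuclideanSpace ℝ (Fin 2) := !₂[Real.cos θ, Real.sin θ]

/-- The length of the chord `{x : x · (cos θ, sin θ) = r} ∩ K`. Length is the one-dimensional
Hausdorff measure, which on a line is the usual length with no further normalization. -/
def chordLength (K : Set (EuclideanSpace ℝ (Fin 2))) (r θ : ℝ) : ℝ :=
  (MeasureTheory.Measure.hausdorffMeasure 1
    ({x : EuclideanSpace ℝ (Fin 2) | inner ℝ x (dirVec θ) = r} ∩ K)).toReal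

/-- The area of the strip `{x : |x · (cos θ, sin θ)| ≤ r} ∩ K`. -/
def stripArea (K : Set (EuclideanSpace ℝ (Fin 2))) (r θ : ℝ) : ℝ :=
  (MeasureTheory.volume
    ({x : EuclideanSpace ℝ (Fin 2) | |inner ℝ x (dirVec θ)| ≤ r} ∩ K)).toReal

end

/-! Since `K` has area 1, `1 - E V` is the probability that a further uniform point `p` of `K`
misses the symmetric hull of the sample. From a point outside a centrally symmetric polygon there
are two tangent lines, from a point inside none. Each tangent passes through one of the points `± x
i`, and a line through `p` and `± x i` is tangent exactly when every `x j` lies in the strip between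
that line and its reflection in the origin. So twice the indicator of `p` missing the hull is a sum
of `2N` strip indicators (`sum_lineStrip_indicator`), valid for `p` in general position, hence
almost everywhere (`ae_isGenericFor`).

Integrating, and using `K = -K`, all `2N` terms agree. The missed area is therefore `N` times the
integral over pairs `(p, y)` in `K` of the `(N-1)`-st power of the strip area
(`lintegral_measure_compl_convexHull`).

The strip depends only on the line through `p` and `y`. With `θ` the angle of the normal, `a` the
signed offset, `s` and `s + ρ` the positions of `p` and `y` along the line, `dp dy = ρ dρ ds da dθ`
(`lintegral_lintegral_eq_lintegral_lines`). A chord of length `ℓ` contributes the integral of `ρ`,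
which is `ℓ³/6`, and the two signs of `a` double this to `ℓ³/3`. -/

open MeasureTheory Set
open scoped ENNReal

/-! ### Counting tangent lines from a point to a symmetric polygon. -/

/-- The determinant of two vectors of the plane. -/
def det2 (x y : EuclideanSpace ℝ (Fin 2)) : ℝ := x 0 * y 1 - x 1 * y 0

/-- The strip symmetric about the origin whose boundary contains the line through `p` and `y`. -/
def lineStrip (p y : EuclideanSpace ℝ (Fin 2)) : Set (EuclideanSpace ℝ (Fin 2)) :=
  {z | |det2 z (p - y)| ≤ |det2 p y|}

theorem mem_lineStrip {p y z : EuclideanSpace ℝ (Fin 2)} :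
    z ∈ lineStrip p y ↔ |det2 z (p - y)| ≤ |det2 p y| := Iff.rfl

theorem det2_neg_left (x y : EuclideanSpace ℝ (Fin 2)) : det2 (-x) y = -det2 x y := by
  simp [det2]; ring

theorem det2_neg_right (x y : EuclideanSpace ℝ (Fin 2)) : det2 x (-y) = -det2 x y := by
  simp [det2]; ring

theorem neg_mem_lineStrip {p y z : EuclideanSpace ℝ (Fin 2)} :
    -z ∈ lineStrip p y ↔ z ∈ lineStrip p y := by
  simp [mem_lineStrip, det2_neg_left]

theorem right_mem_lineStrip (p y : EuclideanSpace ℝ (Fin 2)) : y ∈ lineStrip p y := by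
  rw [mem_lineStrip, ← abs_neg]
  apply le_of_eq
  congr 1
  simp [det2]; ring

theorem exists_det2_eq_one {p : EuclideanSpace ℝ (Fin 2)} (hp : p ≠ 0) :
    ∃ q, det2 p q = 1 := by
  have h : p 0 ^ 2 + p 1 ^ 2 ≠ 0 := by
    intro h
    apply hp
    ext i
    fin_cases i
    · simp; nlinarith [sq_nonneg (p 0), sq_nonneg (p 1)]
    · simp; nlinarith [sq_nonneg (p 0), sq_nonneg (p 1)]
  refine ⟨!₂[-p 1 / (p 0 ^ 2 + p 1 ^ 2), p 0 / (p 0 ^ 2 + p 1 ^ 2)], ?_⟩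
  simp only [det2, Matrix.cons_val_zero, Matrix.cons_val_one]
  field_simp
  ring

/-- The tangency condition in terms of slopes. -/
theorem forall_abs_le_iff_slopes {ι : Type*} (a b : ι → ℝ) (hb : ∀ i, 0 < b i) (i : ι) :
    (∀ j, |b j * (a i - 1) - a j * b i| ≤ b i) ↔
      ∀ j, (1 - a i) / b i ≤ (1 - a j) / b j ∧ 0 ≤ (1 - a i) / b i + (1 + a j) / b j := by
  refine forall_congr' fun j => ?_
  have hi := hb i
  have hj := hb j
  rw [abs_le, div_le_div_iff₀ hi hj, div_add_div _ _ hi.ne' hj.ne', le_div_iff₀ (by positivity)]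
  constructor
  · rintro ⟨h1, h2⟩
    constructor <;> nlinarith
  · rintro ⟨h1, h2⟩
    constructor <;> nlinarith

-- The first condition can hold only at the minimiser of `s`, the second only at the minimiser of
-- `t`, and both minimisers are unique. Geometrically, the slopes of lines whose strip contains all
-- points form the interval from `-t j₀` to `s i₀`, and its ends, when it is nonempty, are the
-- tangents.
open Classical in
theorem sum_tangent_indicator {ι : Type*} [Fintype ι] (s t : ι → ℝ) {i₀ j₀ : ι}
    (hi₀ : ∀ i, s i₀ ≤ s i) (hj₀ : ∀ i, t j₀ ≤ t i) (hs : ∀ i j, i ≠ j → s i ≠ s j) (ht : ∀ i j, i ≠ j → t i ≠ t j) :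
    (∑ i, ((if ∀ j, s i ≤ s j ∧ 0 ≤ s i + t j then (1 : ℝ≥0∞) else 0) +
      if ∀ j, t i ≤ t j ∧ 0 ≤ t i + s j then 1 else 0)) =
      if 0 ≤ s i₀ + t j₀ then 2 else 0 := by
  split_ifs with h
  · have h1 : ∀ i, (∀ j, s i ≤ s j ∧ 0 ≤ s i + t j) ↔ i = i₀ := by
      intro i
      constructor
      · intro hi
        by_contra hne
        exact hs i i₀ hne (le_antisymm (hi i₀).1 (hi₀ i))
      · rintro rfl j
        exact ⟨hi₀ j, by linarith [hj₀ j]⟩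
    have h2 : ∀ i, (∀ j, t i ≤ t j ∧ 0 ≤ t i + s j) ↔ i = j₀ := by
      intro i
      constructor
      · intro hi
        by_contra hne
        exact ht i j₀ hne (le_antisymm (hi j₀).1 (hj₀ i))
      · rintro rfl j
        exact ⟨hj₀ j, by linarith [hi₀ j]⟩
    simp only [h1, h2, Finset.sum_add_distrib, Finset.sum_ite_eq', Finset.mem_univ, if_true]
    exact one_add_one_eq_two
  · apply Finset.sum_eq_zero
    intro i _
    rw [if_neg, if_neg, add_zero]
    · intro hi
      have := hi i₀
      have := (hi j₀).1
      exact h (by linarith)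
    · intro hi
      have := hi j₀
      have := (hi i₀).1
      exact h (by linarith)

/-- The points `± x i`. -/
def symPoints {ι : Type*} (x : ι → EuclideanSpace ℝ (Fin 2)) : Set (EuclideanSpace ℝ (Fin 2)) :=
  range (fun i => x i) ∪ range (fun i => -x i)

/-- No line through `p` and one of the points `± x i` contains the origin or another one of these
points. -/
structure IsGenericFor {ι : Type*} (p : EuclideanSpace ℝ (Fin 2))
    (x : ι → EuclideanSpace ℝ (Fin 2)) : Prop where
  det2_ne : ∀ i, det2 p (x i) ≠ 0
  sub_sub : ∀ i j, i ≠ j → det2 (p - x i) (p - x j) ≠ 0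
  sub_add : ∀ i j, i ≠ j → det2 (p - x i) (p + x j) ≠ 0
  add_add : ∀ i j, i ≠ j → det2 (p + x i) (p + x j) ≠ 0

open Classical in
theorem sum_lineStrip_indicator_of_pos {ι : Type*} [Fintype ι] [Nonempty ι]
    {p : EuclideanSpace ℝ (Fin 2)}
    {x : ι → EuclideanSpace ℝ (Fin 2)} (hx : IsGenericFor p x) (hpos : ∀ i, 0 < det2 p (x i)) :
    (∑ i, ((if ∀ j, x j ∈ lineStrip p (x i) then (1 : ℝ≥0∞) else 0) +
      if ∀ j, x j ∈ lineStrip p (-x i) then 1 else 0)) =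
      if p ∈ convexHull ℝ (symPoints x) then 0 else 2 := by
  obtain ⟨k⟩ := ‹Nonempty ι›
  have hp : p ≠ 0 := by
    rintro rfl
    simpa [det2] using hpos k
  obtain ⟨q, hq⟩ := exists_det2_eq_one hp
  set a : ι → ℝ := fun i => det2 (x i) q with ha
  set b : ι → ℝ := fun i => det2 p (x i) with hbdef
  have hcoord : ∀ i, x i = a i • p + b i • q := by
    intro i
    ext m
    simp only [det2] at hq
    fin_cases m
    · simp [ha, hbdef, det2]; linear_combination (-(x i 0)) * hq
    · simp [ha, hbdef, det2]; linear_combination (-(x i 1)) * hq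
  have hb : ∀ i, 0 < b i := hpos
  have hdet : ∀ i j, det2 (x j) (p - x i) = b j * (a i - 1) - a j * b i := by
    intro i j
    rw [hcoord i, hcoord j]
    simp only [det2, PiLp.add_apply, PiLp.sub_apply, PiLp.smul_apply, smul_eq_mul] at hq ⊢
    linear_combination (b j * (a i - 1) - a j * b i) * hq
  have hdet' : ∀ i j, det2 (x j) (p - -x i) = b j * (-a i - 1) - (-a j) * b i := by
    intro i j
    rw [hcoord i, hcoord j]
    simp only [det2, PiLp.add_apply, PiLp.sub_apply, PiLp.neg_apply, PiLp.smul_apply,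
      smul_eq_mul] at hq ⊢
    linear_combination (b j * (-a i - 1) - (-a j) * b i) * hq
  -- In coordinates `(α, β)` for the basis `p, q`, the lines through `p` avoiding the origin are `α
  -- + c β = 1`. The strip of such a line contains `x j` exactly when `-t j ≤ c ≤ s j`. The line
  -- through `x i` has `c = s i`, the one through `-x i` has `c = -t i`.
  set s : ι → ℝ := fun i => (1 - a i) / b i with hs
  set t : ι → ℝ := fun i => (1 + a i) / b i with ht
  have hS : ∀ i, (∀ j, x j ∈ lineStrip p (x i)) ↔ ∀ j, s i ≤ s j ∧ 0 ≤ s i + t j := by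
    intro i
    rw [← forall_abs_le_iff_slopes a b hb i]
    refine forall_congr' fun j => ?_
    rw [mem_lineStrip, hdet, abs_of_pos (hpos i)]
  have hT : ∀ i, (∀ j, x j ∈ lineStrip p (-x i)) ↔ ∀ j, t i ≤ t j ∧ 0 ≤ t i + s j := by
    intro i
    have h := forall_abs_le_iff_slopes (fun i => -a i) b hb i
    simp only [sub_neg_eq_add, ← sub_eq_add_neg] at h
    rw [← h]
    refine forall_congr' fun j => ?_
    rw [mem_lineStrip, hdet', det2_neg_right, abs_neg, abs_of_pos (hpos i)]
  have hss : ∀ i j, i ≠ j → s i ≠ s j := by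
    intro i j hij h
    apply hx.sub_sub i j hij
    rw [hs] at h
    simp only at h
    rw [div_eq_div_iff (hb i).ne' (hb j).ne'] at h
    rw [hcoord i, hcoord j]
    simp only [det2, PiLp.add_apply, PiLp.sub_apply, PiLp.smul_apply, smul_eq_mul] at hq ⊢
    linear_combination (b i * (1 - a j) - b j * (1 - a i)) * hq - h
  have htt : ∀ i j, i ≠ j → t i ≠ t j := by
    intro i j hij h
    apply hx.add_add i j hij
    rw [ht] at h
    simp only at h
    rw [div_eq_div_iff (hb i).ne' (hb j).ne'] at h
    rw [hcoord i, hcoord j]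
    simp only [det2, PiLp.add_apply, PiLp.smul_apply, smul_eq_mul] at hq ⊢
    linear_combination (-b i * (1 + a j) + b j * (1 + a i)) * hq + h
  have hst : ∀ i j, s i + t j ≠ 0 := by
    intro i j h
    simp only [hs, ht] at h
    rw [div_add_div _ _ (hb i).ne' (hb j).ne', div_eq_zero_iff] at h
    have h : (1 - a i) * b j + b i * (1 + a j) = 0 :=
      h.resolve_right (mul_pos (hb i) (hb j)).ne'
    by_cases hij : i = j
    · subst hij
      nlinarith [hb i]
    · apply hx.sub_add i j hij
      rw [hcoord i, hcoord j]
      simp only [det2, PiLp.add_apply, PiLp.sub_apply, PiLp.smul_apply, smul_eq_mul] at hq ⊢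
      linear_combination ((1 - a i) * b j + b i * (1 + a j)) * hq + h
  obtain ⟨i₀, hi₀⟩ := Finite.exists_min s
  obtain ⟨j₀, hj₀⟩ := Finite.exists_min t
  simp only [hS, hT]
  rw [sum_tangent_indicator s t hi₀ hj₀ hss htt]
  rcases lt_or_gt_of_ne (hst i₀ j₀) with hlt | hgt
  · rw [if_neg (not_le.mpr hlt), if_pos]
    have hbi := hb i₀
    have hbj := hb j₀
    simp only [hs, ht] at hlt
    rw [div_add_div _ _ hbi.ne' hbj.ne', div_lt_iff₀ (by positivity), zero_mul] at hlt
    have hconv := convex_convexHull ℝ (symPoints x)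
    have hi : x i₀ ∈ convexHull ℝ (symPoints x) := subset_convexHull _ _ (Or.inl ⟨i₀, rfl⟩)
    have hi' : -x i₀ ∈ convexHull ℝ (symPoints x) := subset_convexHull _ _ (Or.inr ⟨i₀, rfl⟩)
    have hj : -x j₀ ∈ convexHull ℝ (symPoints x) := subset_convexHull _ _ (Or.inr ⟨j₀, rfl⟩)
    have h0 : (0 : EuclideanSpace ℝ (Fin 2)) ∈ convexHull ℝ (symPoints x) := by
      have := hconv hi hi' (a := 1 / 2) (b := 1 / 2) (by norm_num) (by norm_num) (by norm_num)
      simpa using this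
    have hsum : 0 < b i₀ + b j₀ := by positivity
    -- These weights cancel the `q`-component of `x i₀` and `-x j₀`. The combination is a multiple
    -- `c • p` with `c > 1`, so `p` lies between the origin and a point of the hull.
    have hm := hconv hi hj (a := b j₀ / (b i₀ + b j₀)) (b := b i₀ / (b i₀ + b j₀))
      (by positivity) (by positivity) (by field_simp; ring)
    set c : ℝ := (b j₀ * a i₀ - b i₀ * a j₀) / (b i₀ + b j₀) with hc
    have hc1 : 1 < c := by
      rw [hc, lt_div_iff₀ hsum]
      linarith
    have hmp : (b j₀ / (b i₀ + b j₀)) • x i₀ + (b i₀ / (b i₀ + b j₀)) • -x j₀ = c • p := by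
      rw [hcoord i₀, hcoord j₀, hc]
      ext m
      simp only [PiLp.add_apply, PiLp.neg_apply, PiLp.smul_apply, smul_eq_mul]
      field_simp
      ring
    rw [hmp] at hm
    have := hconv h0 hm (a := 1 - c⁻¹) (b := c⁻¹)
      (sub_nonneg.mpr (inv_le_one_of_one_le₀ hc1.le)) (by positivity) (by ring)
    rwa [smul_zero, zero_add, smul_smul, inv_mul_cancel₀ (by positivity), one_smul] at this
  · rw [if_pos hgt.le, if_neg]
    intro hmem
    -- The midpoint of the nondegenerate interval of admissible slopes: this line through `p`
    -- strictly separates `p` from the hull.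
    set c : ℝ := (s i₀ - t j₀) / 2 with hc
    have hlin : IsLinearMap ℝ fun z : EuclideanSpace ℝ (Fin 2) => det2 z q + c * det2 p z := by
      constructor
      · intro z w
        simp only [det2, PiLp.add_apply]
        ring
      · intro r z
        simp only [det2, PiLp.smul_apply, smul_eq_mul]
        ring
    have hsub : convexHull ℝ (symPoints x) ⊆ {z | det2 z q + c * det2 p z < 1} := by
      refine convexHull_min ?_ (convex_halfSpace_lt hlin 1)
      rintro z (⟨i, rfl⟩ | ⟨i, rfl⟩)
      · have h1 : c < s i := by linarith [hi₀ i]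
        simp only [hs] at h1
        rw [lt_div_iff₀ (hb i)] at h1
        change a i + c * b i < 1
        linarith
      · have h1 : -c < t i := by linarith [hj₀ i]
        simp only [ht] at h1
        rw [lt_div_iff₀ (hb i)] at h1
        simp only [mem_ofPred_eq, det2_neg_left, det2_neg_right]
        change -a i + c * -b i < 1
        linarith
    have hpp := hsub hmem
    have : det2 p p = 0 := by simp only [det2]; ring
    simp only [mem_ofPred_eq, hq, this] at hpp
    linarith

open Classical in
/-- From a point in general position there are two tangent lines to a centrally symmetric polygon
if the point lies outside, and none if it lies inside. -/
theorem sum_lineStrip_indicator {ι : Type*} [Fintype ι] [Nonempty ι]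
    {p : EuclideanSpace ℝ (Fin 2)} {x : ι → EuclideanSpace ℝ (Fin 2)} (hx : IsGenericFor p x) :
    (∑ i, ((if ∀ j, x j ∈ lineStrip p (x i) then (1 : ℝ≥0∞) else 0) +
      if ∀ j, x j ∈ lineStrip p (-x i) then 1 else 0)) =
      if p ∈ convexHull ℝ (symPoints x) then 0 else 2 := by
  -- Changing the sign of an `x i` affects neither the hull nor membership in strips, and only swaps
  -- the two indicators of the index `i`. Hence all determinants may be taken positive.
  set y : ι → EuclideanSpace ℝ (Fin 2) := fun i => if 0 < det2 p (x i) then x i else -x i with hy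
  have hcase : ∀ i, y i = x i ∨ y i = -x i := by
    intro i
    simp only [hy]
    split_ifs <;> simp
  have hpos : ∀ i, 0 < det2 p (y i) := by
    intro i
    simp only [hy]
    split_ifs with h
    · exact h
    · rw [det2_neg_right]
      have := hx.det2_ne i
      have : det2 p (x i) < 0 := lt_of_le_of_ne (not_lt.mp h) this
      linarith
  have hswap : ∀ u v, det2 u v = -det2 v u := by
    intro u v
    simp only [det2]; ring
  have hgen : IsGenericFor p y := by
    refine ⟨fun i => (hpos i).ne', ?_, ?_, ?_⟩ <;> intro i j hij <;>
      rcases hcase i with hi | hi <;> rcases hcase j with hj | hj <;> rw [hi, hj] <;>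
      try simp only [sub_neg_eq_add, ← sub_eq_add_neg]
    · exact hx.sub_sub i j hij
    · exact hx.sub_add i j hij
    · rw [hswap]; exact neg_ne_zero.mpr (hx.sub_add j i hij.symm)
    · exact hx.add_add i j hij
    · exact hx.sub_add i j hij
    · exact hx.sub_sub i j hij
    · exact hx.add_add i j hij
    · rw [hswap]; exact neg_ne_zero.mpr (hx.sub_add j i hij.symm)
    · exact hx.add_add i j hij
    · rw [hswap]; exact neg_ne_zero.mpr (hx.sub_add j i hij.symm)
    · exact hx.sub_add i j hij
    · exact hx.sub_sub i j hij
  have hset : symPoints y = symPoints x := by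
    ext z
    simp only [symPoints, mem_union, mem_range, ← exists_or]
    refine exists_congr fun i => ?_
    rcases hcase i with hi | hi <;> rw [hi]
    rw [neg_neg, or_comm]
  have hmem : ∀ u j, y j ∈ lineStrip p u ↔ x j ∈ lineStrip p u := by
    intro u j
    rcases hcase j with hj | hj <;> rw [hj]
    rw [neg_mem_lineStrip]
  have h := sum_lineStrip_indicator_of_pos hgen hpos
  rw [hset] at h
  rw [← h]
  refine Finset.sum_congr rfl fun i _ => ?_
  simp only [hmem]
  rcases hcase i with hi | hi <;> rw [hi]
  rw [neg_neg, add_comm]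

/-! ### Null sets and general position. -/

@[fun_prop]
theorem Continuous.det2 {α : Type*} [TopologicalSpace α] {f g : α → EuclideanSpace ℝ (Fin 2)}
    (hf : Continuous f) (hg : Continuous g) : Continuous fun a => det2 (f a) (g a) := by
  unfold _root_.det2
  fun_prop

theorem isClosed_mem_lineStrip {α : Type*} [TopologicalSpace α]
    {f g h : α → EuclideanSpace ℝ (Fin 2)} (hf : Continuous f) (hg : Continuous g)
    (hh : Continuous h) : IsClosed {a | f a ∈ lineStrip (g a) (h a)} := by
  simp only [mem_lineStrip]
  exact isClosed_le (by fun_prop) (by fun_prop)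

/-- A line in the plane has zero area. -/
theorem volume_det2_eq {w : EuclideanSpace ℝ (Fin 2)} (hw : w ≠ 0) (c : ℝ) :
    volume {z | det2 z w = c} = 0 := by
  have hswap : ∀ u v, det2 u v = -det2 v u := by
    intro u v
    simp only [det2]; ring
  obtain ⟨q, hq⟩ := exists_det2_eq_one hw
  let L : EuclideanSpace ℝ (Fin 2) →ₗ[ℝ] ℝ :=
    { toFun := fun z => det2 z w
      map_add' := fun z z' => by simp only [det2, PiLp.add_apply]; ring
      map_smul' := fun r z => by
        simp only [det2, PiLp.smul_apply, smul_eq_mul, RingHom.id_apply]; ring }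
  have hL : LinearMap.ker L ≠ ⊤ := by
    intro h
    have hmem : q ∈ LinearMap.ker L := by rw [h]; trivial
    have h0 : det2 q w = 0 := hmem
    rw [hswap, hq] at h0
    norm_num at h0
  have h0 := Measure.addHaar_submodule volume _ hL
  have heq : {z | det2 z w = c} = (fun z => c • q + z) ⁻¹' (LinearMap.ker L : Set _) := by
    ext z
    have : L (c • q + z) = det2 z w - c := by
      rw [map_add, map_smul]
      change c • det2 q w + det2 z w = _
      rw [hswap q, hq, smul_eq_mul]
      ring
    simp only [mem_ofPred_eq, mem_preimage, SetLike.mem_coe, LinearMap.mem_ker, this, sub_eq_zero]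
  rw [heq, measure_preimage_add, h0]

/-- A nonzero linear map on configurations is almost everywhere nonzero. -/
theorem ae_pi_linearMap_ne_zero {ι F : Type*} [Fintype ι] [AddCommGroup F] [Module ℝ F]
    (K : Set (EuclideanSpace ℝ (Fin 2))) (L : (ι → EuclideanSpace ℝ (Fin 2)) →ₗ[ℝ] F)
    (hL : L ≠ 0) : ∀ᵐ x ∂(Measure.pi fun _ : ι => volume.restrict K), L x ≠ 0 := by
  rw [← Measure.restrict_pi_pi, ← volume_pi]
  apply ae_restrict_of_ae
  have : LinearMap.ker L ≠ ⊤ := by rwa [Ne, LinearMap.ker_eq_top]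
  rw [ae_iff]
  exact measure_mono_null (fun x hx => by simpa using hx) (Measure.addHaar_submodule volume _ this)

/-- For fixed `x`, each condition says that `p` avoids a line `det2 p w = c` with `w` one of `x i`,
`x i - x j`, `x i + x j`. These vectors are nonzero for almost every `x`. -/
theorem ae_isGenericFor (K : Set (EuclideanSpace ℝ (Fin 2))) (ι : Type*) [Fintype ι] :
    ∀ᵐ x ∂(Measure.pi fun _ : ι => volume.restrict K), ∀ᵐ p ∂(volume.restrict K),
      IsGenericFor p x := by
  classical
  obtain ⟨e, he⟩ := exists_ne (0 : EuclideanSpace ℝ (Fin 2))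
  have h1 : ∀ᵐ x ∂(Measure.pi fun _ : ι => volume.restrict K), ∀ i, x i ≠ 0 := by
    rw [ae_all_iff]
    intro i
    refine ae_pi_linearMap_ne_zero K (LinearMap.proj i) fun h => he ?_
    simpa using LinearMap.congr_fun h (Pi.single i e)
  have h2 : ∀ᵐ x ∂(Measure.pi fun _ : ι => volume.restrict K),
      ∀ i j, i ≠ j → x i - x j ≠ 0 := by
    simp only [ae_all_iff]
    intro i j hij
    let L : (ι → EuclideanSpace ℝ (Fin 2)) →ₗ[ℝ] EuclideanSpace ℝ (Fin 2) :=
      LinearMap.proj (R := ℝ) (φ := fun _ : ι => EuclideanSpace ℝ (Fin 2)) i -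
        LinearMap.proj (R := ℝ) (φ := fun _ : ι => EuclideanSpace ℝ (Fin 2)) j
    refine ae_pi_linearMap_ne_zero K L fun h => he ?_
    simpa [L, hij.symm] using LinearMap.congr_fun h (Pi.single i e)
  have h3 : ∀ᵐ x ∂(Measure.pi fun _ : ι => volume.restrict K),
      ∀ i j, i ≠ j → x i + x j ≠ 0 := by
    simp only [ae_all_iff]
    intro i j hij
    let L : (ι → EuclideanSpace ℝ (Fin 2)) →ₗ[ℝ] EuclideanSpace ℝ (Fin 2) :=
      LinearMap.proj (R := ℝ) (φ := fun _ : ι => EuclideanSpace ℝ (Fin 2)) i +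
        LinearMap.proj (R := ℝ) (φ := fun _ : ι => EuclideanSpace ℝ (Fin 2)) j
    refine ae_pi_linearMap_ne_zero K L fun h => he ?_
    simpa [L, hij.symm] using LinearMap.congr_fun h (Pi.single i e)
  filter_upwards [h1, h2, h3] with x h1 h2 h3
  have hline : ∀ w : EuclideanSpace ℝ (Fin 2), w ≠ 0 → ∀ c : ℝ,
      ∀ᵐ p ∂(volume.restrict K), det2 p w ≠ c := by
    intro w hw c
    apply ae_restrict_of_ae
    rw [ae_iff]
    simpa using volume_det2_eq hw c
  have g1 : ∀ᵐ p ∂(volume.restrict K), ∀ i, det2 p (x i) ≠ 0 :=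
    ae_all_iff.mpr fun i => hline _ (h1 i) 0
  have g2 : ∀ᵐ p ∂(volume.restrict K), ∀ i j, i ≠ j →
      det2 p (x i - x j) ≠ -det2 (x i) (x j) ∧ det2 p (x i - x j) ≠ det2 (x i) (x j) := by
    simp only [ae_all_iff]
    exact fun i j hij => (hline _ (h2 i j hij) _).and (hline _ (h2 i j hij) _)
  have g3 : ∀ᵐ p ∂(volume.restrict K), ∀ i j, i ≠ j →
      det2 p (x i + x j) ≠ det2 (x i) (x j) := by
    simp only [ae_all_iff]
    exact fun i j hij => hline _ (h3 i j hij) _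
  filter_upwards [g1, g2, g3] with p g1 g2 g3
  refine ⟨g1, fun i j hij h => (g2 i j hij).1 ?_, fun i j hij h => g3 i j hij ?_,
    fun i j hij h => (g2 i j hij).2 ?_⟩ <;>
  simp only [det2, PiLp.add_apply, PiLp.sub_apply] at h ⊢ <;>
  linarith

/-! ### The expected missed area as an integral over pairs of points. -/

theorem measurableSet_forall_mem_lineStrip {ι : Type*} [Finite ι]
    {σ : EuclideanSpace ℝ (Fin 2) → EuclideanSpace ℝ (Fin 2)} (hσ : Continuous σ) (i : ι) :
    MeasurableSet {a : (ι → EuclideanSpace ℝ (Fin 2)) × EuclideanSpace ℝ (Fin 2) |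
      ∀ j, a.1 j ∈ lineStrip a.2 (σ (a.1 i))} := by
  have := Fintype.ofFinite ι
  refine IsClosed.measurableSet ?_
  simp only [ofPred_forall]
  exact isClosed_iInter fun j =>
    isClosed_mem_lineStrip (by fun_prop) (by fun_prop) (by fun_prop)

theorem measurable_measure_lineStrip (μ : Measure (EuclideanSpace ℝ (Fin 2))) [SFinite μ] :
    Measurable fun a : EuclideanSpace ℝ (Fin 2) × EuclideanSpace ℝ (Fin 2) =>
      μ (lineStrip a.1 a.2) := by
  have h : MeasurableSet {a : (EuclideanSpace ℝ (Fin 2) × EuclideanSpace ℝ (Fin 2)) ×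
      EuclideanSpace ℝ (Fin 2) | a.2 ∈ lineStrip a.1.1 a.1.2} :=
    (isClosed_mem_lineStrip (by fun_prop) (by fun_prop) (by fun_prop)).measurableSet
  exact measurable_measure_prodMk_left h

/-- Given `p` and `x i`, the other points fall into the strip independently. It is applied with `σ`
the identity and the negation, whose invariance of `μ` makes both values equal. -/
theorem lintegral_pi_measure_forall_mem_lineStrip (μ : Measure (EuclideanSpace ℝ (Fin 2)))
    [IsProbabilityMeasure μ] {σ : EuclideanSpace ℝ (Fin 2) → EuclideanSpace ℝ (Fin 2)}
    (hσ : Continuous σ) (hμ : MeasurePreserving σ μ μ)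
    (hself : ∀ p y, y ∈ lineStrip p (σ y)) {n : ℕ} (i : Fin (n + 1)) :
    ∫⁻ x, μ {p | ∀ j, x j ∈ lineStrip p (σ (x i))} ∂(Measure.pi fun _ : Fin (n + 1) => μ) =
      ∫⁻ p, ∫⁻ y, μ (lineStrip p y) ^ n ∂μ ∂μ := by
  have hms := measurableSet_forall_mem_lineStrip hσ i
  refine (Measure.prod_apply hms).symm.trans ((Measure.prod_apply_symm hms).trans ?_)
  refine lintegral_congr fun p => ?_
  have hm : MeasurableSet {a : EuclideanSpace ℝ (Fin 2) × (Fin n → EuclideanSpace ℝ (Fin 2)) |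
      ∀ j, a.2 j ∈ lineStrip p (σ a.1)} := by
    refine IsClosed.measurableSet ?_
    simp only [ofPred_forall]
    exact isClosed_iInter fun j =>
      isClosed_mem_lineStrip (by fun_prop) (by fun_prop) (by fun_prop)
  have hmp := measurePreserving_piFinSuccAbove (fun _ : Fin (n + 1) => μ) i
  have hpow : Measurable fun y => μ (lineStrip p y) ^ n :=
    ((measurable_measure_lineStrip μ).comp measurable_prodMk_left).pow_const n
  have hset : (fun x : Fin (n + 1) → EuclideanSpace ℝ (Fin 2) => (x, p)) ⁻¹'
      {a | ∀ j, a.1 j ∈ lineStrip a.2 (σ (a.1 i))} =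
      MeasurableEquiv.piFinSuccAbove (fun _ => EuclideanSpace ℝ (Fin 2)) i ⁻¹'
        {a | ∀ j, a.2 j ∈ lineStrip p (σ a.1)} := by
    ext x
    change (∀ j, x j ∈ lineStrip p (σ (x i))) ↔
      ∀ j : Fin n, x (i.succAbove j) ∈ lineStrip p (σ (x i))
    -- The condition for `j = i` is automatic, which leaves `n` free points and gives the exponent
    -- `n = N - 1`.
    rw [Fin.forall_iff_succAbove i]
    exact and_iff_right (hself p (x i))
  rw [hset, hmp.measure_preimage hm.nullMeasurableSet, Measure.prod_apply hm,
    ← hμ.lintegral_comp hpow]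
  refine lintegral_congr fun y => ?_
  have : Prod.mk y ⁻¹' {a : EuclideanSpace ℝ (Fin 2) × (Fin n → EuclideanSpace ℝ (Fin 2)) |
      ∀ j, a.2 j ∈ lineStrip p (σ a.1)} = Set.pi univ fun _ => lineStrip p (σ y) := by
    ext z
    simp
  rw [this, Measure.pi_pi]
  simp

theorem measurePreserving_neg_restrict {K : Set (EuclideanSpace ℝ (Fin 2))} (hK : K = -K)
    (hm : MeasurableSet K) :
    MeasurePreserving (fun y : EuclideanSpace ℝ (Fin 2) => -y) (volume.restrict K)
      (volume.restrict K) := by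
  have h := (Measure.measurePreserving_neg
    (volume : Measure (EuclideanSpace ℝ (Fin 2)))).restrict_preimage hm
  have h2 : Neg.neg ⁻¹' K = K := hK.symm
  rwa [h2] at h

theorem isClosed_convexHull_symPoints {ι : Type*} [Finite ι] (x : ι → EuclideanSpace ℝ (Fin 2)) :
    IsClosed (convexHull ℝ (symPoints x)) :=
  (((finite_range _).union (finite_range _)).isCompact_convexHull ℝ).isClosed

/-- The expected missed area of the symmetric hull, as an integral over pairs of points. -/
theorem lintegral_measure_compl_convexHull {K : Set (EuclideanSpace ℝ (Fin 2))} (hK : K = -K)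
    (hm : MeasurableSet K) (hvol : volume K = 1) (n : ℕ) :
    AEMeasurable (fun x => volume.restrict K (convexHull ℝ (symPoints x))ᶜ)
        (Measure.pi fun _ : Fin (n + 1) => volume.restrict K) ∧
      ∫⁻ x, volume.restrict K (convexHull ℝ (symPoints x))ᶜ
        ∂(Measure.pi fun _ : Fin (n + 1) => volume.restrict K) =
      (n + 1 : ℕ) * ∫⁻ p in K, ∫⁻ y in K, volume.restrict K (lineStrip p y) ^ n := by
  have hprob : IsProbabilityMeasure (volume.restrict K) := ⟨by simpa using hvol⟩
  have hmeas1 := fun i : Fin (n + 1) => measurableSet_forall_mem_lineStrip continuous_id i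
  have hmeas2 := fun i : Fin (n + 1) => measurableSet_forall_mem_lineStrip continuous_neg i
  have hgen := ae_isGenericFor K (Fin (n + 1))
  have hneg := measurePreserving_neg_restrict hK hm
  generalize volume.restrict K = μ at *
  have hcount : ∀ᵐ x ∂(Measure.pi fun _ : Fin (n + 1) => μ),
      (2 : ℝ≥0∞) * μ (convexHull ℝ (symPoints x))ᶜ =
      ∑ i, (μ {p | ∀ j, x j ∈ lineStrip p (x i)} + μ {p | ∀ j, x j ∈ lineStrip p (-x i)}) := by
    filter_upwards [hgen] with x hx
    have h1 : ∀ i, MeasurableSet {p | ∀ j, x j ∈ lineStrip p (x i)} :=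
      fun i => measurable_prodMk_left (hmeas1 i)
    have h2 : ∀ i, MeasurableSet {p | ∀ j, x j ∈ lineStrip p (-x i)} :=
      fun i => measurable_prodMk_left (hmeas2 i)
    have hc := (isClosed_convexHull_symPoints x).measurableSet
    rw [← lintegral_indicator_const hc.compl]
    simp only [← lintegral_indicator_one (h1 _), ← lintegral_indicator_one (h2 _)]
    simp only [← lintegral_add_left (measurable_one.indicator (h1 _))]
    rw [← lintegral_finsetSum _ fun i _ =>
      (measurable_one.indicator (h1 i)).fun_add (measurable_one.indicator (h2 i))]
    refine lintegral_congr_ae ?_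
    filter_upwards [hx] with p hp
    classical
    have := sum_lineStrip_indicator hp
    simp only [indicator_apply, mem_compl_iff, mem_ofPred_eq, Pi.one_apply, ite_not]
    convert this.symm
  have hV1 : ∀ i, Measurable fun x : Fin (n + 1) → EuclideanSpace ℝ (Fin 2) =>
      μ {p | ∀ j, x j ∈ lineStrip p (x i)} := fun i => measurable_measure_prodMk_left (hmeas1 i)
  have hV2 : ∀ i, Measurable fun x : Fin (n + 1) → EuclideanSpace ℝ (Fin 2) =>
      μ {p | ∀ j, x j ∈ lineStrip p (-x i)} := fun i => measurable_measure_prodMk_left (hmeas2 i)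
  have hsum : Measurable fun x : Fin (n + 1) → EuclideanSpace ℝ (Fin 2) =>
      ∑ i, (μ {p | ∀ j, x j ∈ lineStrip p (x i)} + μ {p | ∀ j, x j ∈ lineStrip p (-x i)}) :=
    Finset.measurable_fun_sum _ fun i _ => (hV1 i).fun_add (hV2 i)
  -- Measurability of the missed area is read off the counting identity, whose right side is
  -- measurable.
  have hae : AEMeasurable (fun x => μ (convexHull ℝ (symPoints x))ᶜ)
      (Measure.pi fun _ : Fin (n + 1) => μ) := by
    refine ⟨_, hsum.const_mul (2⁻¹ : ℝ≥0∞), ?_⟩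
    filter_upwards [hcount] with x hx
    rw [← hx, ← mul_assoc, ENNReal.inv_mul_cancel (by norm_num) (by norm_num), one_mul]
  refine ⟨hae, ?_⟩
  have hI1 := fun i : Fin (n + 1) => lintegral_pi_measure_forall_mem_lineStrip μ continuous_id
    (MeasurePreserving.id μ) right_mem_lineStrip i
  have hI2 := fun i : Fin (n + 1) => lintegral_pi_measure_forall_mem_lineStrip μ continuous_neg
    hneg (fun p y => neg_mem_lineStrip.mp (right_mem_lineStrip p (-y))) i
  simp only [id] at hI1
  -- The factor 2 counts the two tangents. It cancels against the two signs of each of the `n + 1`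
  -- points.
  have h2 : (2 : ℝ≥0∞) * ∫⁻ x, μ (convexHull ℝ (symPoints x))ᶜ
      ∂(Measure.pi fun _ : Fin (n + 1) => μ) =
      2 * ((n + 1 : ℕ) * ∫⁻ p, ∫⁻ y, μ (lineStrip p y) ^ n ∂μ ∂μ) := by
    rw [← lintegral_const_mul'' _ hae, lintegral_congr_ae hcount,
      lintegral_finsetSum _ fun i _ => (hV1 i).fun_add (hV2 i)]
    simp only [lintegral_add_left (hV1 _), hI1, hI2, ← two_mul, Finset.sum_const,
      Finset.card_univ, Fintype.card_fin, nsmul_eq_mul]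
    ring
  exact (ENNReal.mul_right_inj (by norm_num) (by norm_num)).mp h2

/-! ### Pairs of points in coordinates of the line joining them. -/

/-- The unit vector orthogonal to `dirVec θ`. -/
noncomputable def tanVec (θ : ℝ) : EuclideanSpace ℝ (Fin 2) := !₂[-Real.sin θ, Real.cos θ]

/-- The point with coordinates `a` in the orthonormal frame `dirVec θ`, `tanVec θ`. -/
noncomputable def framePoint (θ : ℝ) (a : ℝ × ℝ) : EuclideanSpace ℝ (Fin 2) :=
  a.1 • dirVec θ + a.2 • tanVec θ

@[simp] theorem dirVec_zero (θ : ℝ) : dirVec θ 0 = Real.cos θ := rfl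
@[simp] theorem dirVec_one (θ : ℝ) : dirVec θ 1 = Real.sin θ := rfl
@[simp] theorem tanVec_zero (θ : ℝ) : tanVec θ 0 = -Real.sin θ := rfl
@[simp] theorem tanVec_one (θ : ℝ) : tanVec θ 1 = Real.cos θ := rfl

theorem framePoint_zero (θ : ℝ) (a : ℝ × ℝ) :
    framePoint θ a 0 = a.1 * Real.cos θ - a.2 * Real.sin θ := by
  simp [framePoint]; ring

theorem framePoint_one (θ : ℝ) (a : ℝ × ℝ) :
    framePoint θ a 1 = a.1 * Real.sin θ + a.2 * Real.cos θ := by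
  simp [framePoint]

@[fun_prop]
theorem continuous_dirVec : Continuous dirVec := by
  unfold dirVec
  refine (PiLp.continuous_toLp 2 _).comp (continuous_pi fun i => ?_)
  fin_cases i <;> simp <;> fun_prop

@[fun_prop]
theorem continuous_tanVec : Continuous tanVec := by
  unfold tanVec
  refine (PiLp.continuous_toLp 2 _).comp (continuous_pi fun i => ?_)
  fin_cases i <;> simp <;> fun_prop

@[fun_prop]
theorem Continuous.framePoint {α : Type*} [TopologicalSpace α] {f : α → ℝ} {g : α → ℝ × ℝ}
    (hf : Continuous f) (hg : Continuous g) : Continuous fun x => framePoint (f x) (g x) := by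
  unfold _root_.framePoint
  fun_prop

theorem measurePreserving_framePoint (θ : ℝ) :
    MeasurePreserving (framePoint θ) volume volume := by
  let L : EuclideanSpace ℝ (Fin 2) →ₗᵢ[ℝ] EuclideanSpace ℝ (Fin 2) :=
    { toFun := fun z => framePoint θ (z 0, z 1)
      map_add' := fun z w => by simp only [framePoint, PiLp.add_apply, add_smul]; abel
      map_smul' := fun r z => by
        simp only [framePoint, PiLp.smul_apply, smul_eq_mul, mul_smul, smul_add, RingHom.id_apply]
      norm_map' := fun z => by
        change ‖framePoint θ (z 0, z 1)‖ = ‖z‖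
        rw [EuclideanSpace.norm_eq, EuclideanSpace.norm_eq]
        congr 1
        simp only [Fin.sum_univ_two, framePoint_zero, framePoint_one, Real.norm_eq_abs, sq_abs]
        linear_combination (z 0 ^ 2 + z 1 ^ 2) * Real.sin_sq_add_cos_sq θ }
  have hL := (L.toLinearIsometryEquiv rfl).measurePreserving
  have h1 := (volume_preserving_finTwoArrow ℝ).symm
  have h2 := (EuclideanSpace.volume_preserving_symm_measurableEquiv_toLp (Fin 2)).symm
  exact hL.comp (h2.comp h1)

/-- Polar coordinates in the plane, the angle being that of the normal. -/
theorem lintegral_eq_lintegral_tanVec (f : EuclideanSpace ℝ (Fin 2) → ℝ≥0∞) (hf : Measurable f) :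
    ∫⁻ w, f w = ∫⁻ q in Ioi (0 : ℝ) ×ˢ Ioo (-Real.pi) Real.pi,
      ENNReal.ofReal q.1 * f (q.1 • tanVec q.2) := by
  -- A quarter turn carries `(ρ cos θ, ρ sin θ)` to `ρ • tanVec θ`.
  rw [← (measurePreserving_framePoint (Real.pi / 2)).lintegral_comp hf,
    ← lintegral_comp_polarCoord_symm, polarCoord_target]
  refine lintegral_congr fun q => ?_
  rw [smul_eq_mul]
  congr 2
  ext i
  fin_cases i
  · simp [framePoint]
  · simp [framePoint]

/-- The measure of pairs of points in coordinates adapted to the line through them. -/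
theorem lintegral_lintegral_eq_lintegral_lines
    {F : EuclideanSpace ℝ (Fin 2) × EuclideanSpace ℝ (Fin 2) → ℝ≥0∞} (hF : Measurable F) :
    ∫⁻ p, ∫⁻ y, F (p, y) = ∫⁻ θ in Ioo (-Real.pi) Real.pi, ∫⁻ a : ℝ, ∫⁻ s : ℝ,
      ∫⁻ ρ in Ioi (0 : ℝ), ENNReal.ofReal ρ * F (framePoint θ (a, s), framePoint θ (a, s + ρ)) := by
  have hadd : ∀ θ a s ρ, framePoint θ (a, s) + ρ • tanVec θ = framePoint θ (a, s + ρ) := by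
    intro θ a s ρ
    simp only [framePoint, add_smul, add_assoc]
  have hm : ∀ {α : Type} [MeasurableSpace α] [TopologicalSpace α] [BorelSpace α]
      (f g : α → EuclideanSpace ℝ (Fin 2)) (r : α → ℝ), Continuous f → Continuous g →
      Continuous r → Measurable fun x => ENNReal.ofReal (r x) * F (f x, g x) :=
    fun f g r hf hg hr =>
      hr.measurable.ennreal_ofReal.mul (hF.comp (hf.measurable.prodMk hg.measurable))
  -- Polar coordinates for the difference `w = y - p` bring in the Jacobian `ρ`. Then `p` is
  -- expressed in the frame of the resulting angle, a rotation that costs no further factor.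
  calc ∫⁻ p, ∫⁻ y, F (p, y)
      = ∫⁻ p, ∫⁻ w, F (p, p + w) := by
        refine lintegral_congr fun p => ?_
        rw [lintegral_add_left_eq_self (fun y => F (p, y)) p]
    _ = ∫⁻ p, ∫⁻ q in Ioi (0 : ℝ) ×ˢ Ioo (-Real.pi) Real.pi,
          ENNReal.ofReal q.1 * F (p, p + q.1 • tanVec q.2) := by
        refine lintegral_congr fun p => ?_
        refine lintegral_eq_lintegral_tanVec (fun w => F (p, p + w)) ?_
        exact hF.comp (by fun_prop)
    _ = ∫⁻ q in Ioi (0 : ℝ) ×ˢ Ioo (-Real.pi) Real.pi, ∫⁻ p,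
          ENNReal.ofReal q.1 * F (p, p + q.1 • tanVec q.2) := by
        rw [lintegral_lintegral_swap]
        exact (hm _ _ _ (by fun_prop) (by fun_prop) (by fun_prop)).aemeasurable
    _ = ∫⁻ q in Ioi (0 : ℝ) ×ˢ Ioo (-Real.pi) Real.pi, ∫⁻ b : ℝ × ℝ,
          ENNReal.ofReal q.1 * F (framePoint q.2 b, framePoint q.2 b + q.1 • tanVec q.2) := by
        refine lintegral_congr fun q => ?_
        rw [← (measurePreserving_framePoint q.2).lintegral_comp]
        exact hm _ _ _ (by fun_prop) (by fun_prop) (by fun_prop)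
    _ = ∫⁻ θ in Ioo (-Real.pi) Real.pi, ∫⁻ ρ in Ioi (0 : ℝ), ∫⁻ b : ℝ × ℝ,
          ENNReal.ofReal ρ * F (framePoint θ b, framePoint θ b + ρ • tanVec θ) := by
        rw [Measure.volume_eq_prod, ← Measure.prod_restrict, lintegral_prod_symm]
        refine (Measurable.lintegral_prod_right' (f := fun c : (ℝ × ℝ) × (ℝ × ℝ) =>
          ENNReal.ofReal c.1.1 * F (framePoint c.1.2 c.2,
            framePoint c.1.2 c.2 + c.1.1 • tanVec c.1.2)) ?_).aemeasurable
        exact hm _ _ _ (by fun_prop) (by fun_prop) (by fun_prop)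
    _ = _ := by
        refine lintegral_congr fun θ => ?_
        rw [lintegral_lintegral_swap, Measure.volume_eq_prod, lintegral_prod]
        · simp only [hadd]
        · refine (Measurable.lintegral_prod_right' (f := fun c : (ℝ × ℝ) × ℝ =>
            ENNReal.ofReal c.2 * F (framePoint θ c.1,
              framePoint θ c.1 + c.2 • tanVec θ)) ?_).aemeasurable
          exact hm _ _ _ (by fun_prop) (by fun_prop) (by fun_prop)
        · exact (hm _ _ _ (by fun_prop) (by fun_prop) (by fun_prop)).aemeasurable

/-- The inner integral is `(d - s)² / 2`. As `ρ > 0`, only pairs with the second point further along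
count, so the result is half of the integral of `|s - s'|` over the square. -/
theorem lintegral_lintegral_Icc_mul_sub {c d : ℝ} (hcd : c ≤ d) :
    ∫⁻ s, ∫⁻ ρ in Ioi (0 : ℝ), ENNReal.ofReal ρ *
      ((Icc c d).indicator 1 s * (Icc c d).indicator 1 (s + ρ)) =
      ENNReal.ofReal ((d - c) ^ 3 / 6) := by
  have hinner : ∀ s, ∫⁻ ρ in Ioi (0 : ℝ), ENNReal.ofReal ρ *
      ((Icc c d).indicator 1 s * (Icc c d).indicator 1 (s + ρ)) =
      (Icc c d).indicator (fun s => ENNReal.ofReal ((d - s) ^ 2 / 2)) s := by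
    intro s
    by_cases hs : s ∈ Icc c d
    · have h0 : 0 ≤ d - s := sub_nonneg.mpr hs.2
      have h1 : ∀ ρ ∈ Ioi (0 : ℝ), ENNReal.ofReal ρ *
          ((Icc c d).indicator 1 s * (Icc c d).indicator 1 (s + ρ)) =
          (Ioc 0 (d - s)).indicator (fun ρ => ENNReal.ofReal ρ) ρ := by
        intro ρ hρ
        have hρ : 0 < ρ := hρ
        rw [indicator_of_mem hs]
        by_cases h : ρ ≤ d - s
        · rw [indicator_of_mem (show ρ ∈ Ioc 0 (d - s) from ⟨hρ, h⟩),
            indicator_of_mem (show s + ρ ∈ Icc c d from ⟨by linarith [hs.1], by linarith⟩)]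
          simp
        · rw [indicator_of_notMem (show ρ ∉ Ioc 0 (d - s) from fun h' => h h'.2),
            indicator_of_notMem (show s + ρ ∉ Icc c d from fun h' => h (by linarith [h'.2]))]
          simp
      rw [setLIntegral_congr_fun measurableSet_Ioi h1, lintegral_indicator measurableSet_Ioc,
        Measure.restrict_restrict measurableSet_Ioc, inter_eq_left.mpr Ioc_subset_Ioi_self,
        indicator_of_mem hs, ← ofReal_integral_eq_lintegral_ofReal,
        ← intervalIntegral.integral_of_le h0, integral_id]
      · simp
      · exact (continuous_id.integrableOn_Icc).mono_set Ioc_subset_Icc_self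
      · filter_upwards [ae_restrict_mem measurableSet_Ioc] with ρ hρ using hρ.1.le
    · simp [hs]
  simp only [hinner]
  rw [lintegral_indicator measurableSet_Icc, ← ofReal_integral_eq_lintegral_ofReal,
    integral_Icc_eq_integral_Ioc, ← intervalIntegral.integral_of_le hcd]
  · congr 1
    have := intervalIntegral.integral_comp_sub_left (a := c) (b := d) (fun x : ℝ => x ^ 2 / 2) d
    rw [this]
    simp [integral_pow]
    ring
  · exact (by fun_prop : Continuous fun s : ℝ => (d - s) ^ 2 / 2).integrableOn_Icc
  · exact Filter.Eventually.of_forall fun s => by positivity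

theorem lintegral_lintegral_indicator_mul_sub {I : Set ℝ} (hc : IsCompact I) (hI : Convex ℝ I) :
    ∫⁻ s, ∫⁻ ρ in Ioi (0 : ℝ), ENNReal.ofReal ρ * (I.indicator 1 s * I.indicator 1 (s + ρ)) =
      ENNReal.ofReal ((volume I).toReal ^ 3 / 6) := by
  rcases I.eq_empty_or_nonempty with rfl | hne
  · simp
  · have hEq := eq_Icc_of_connected_compact ⟨hne, hI.isPreconnected⟩ hc
    have hle : sInf I ≤ sSup I := by
      obtain ⟨x, hx⟩ := hne
      rw [hEq] at hx
      exact hx.1.trans hx.2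
    rw [hEq, lintegral_lintegral_Icc_mul_sub hle, Real.volume_Icc,
      ENNReal.toReal_ofReal (sub_nonneg.mpr hle)]

/-! ### Strips and chords of a symmetric convex body. -/

theorem det2_tanVec (z : EuclideanSpace ℝ (Fin 2)) (θ : ℝ) :
    det2 z (tanVec θ) = inner ℝ z (dirVec θ) := by
  simp [det2, PiLp.inner_apply, Fin.sum_univ_two]
  ring

theorem inner_framePoint (θ : ℝ) (a : ℝ × ℝ) : inner ℝ (framePoint θ a) (dirVec θ) = a.1 := by
  simp only [PiLp.inner_apply, Fin.sum_univ_two, framePoint_zero, framePoint_one, dirVec_zero,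
    dirVec_one, RCLike.inner_apply, conj_trivial]
  linear_combination a.1 * Real.sin_sq_add_cos_sq θ

/-- Both determinants carry the same factor `ρ`. Independence of `s` and `ρ` lets the strip area
leave the integral along the chord. -/
theorem lineStrip_framePoint (θ a s : ℝ) {ρ : ℝ} (hρ : 0 < ρ) :
    lineStrip (framePoint θ (a, s)) (framePoint θ (a, s + ρ)) =
      {z | |inner ℝ z (dirVec θ)| ≤ |a|} := by
  ext z
  have h1 : det2 z (framePoint θ (a, s) - framePoint θ (a, s + ρ)) =
      -ρ * inner ℝ z (dirVec θ) := by
    rw [← det2_tanVec]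
    simp only [det2, PiLp.sub_apply, framePoint_zero, framePoint_one, tanVec_zero, tanVec_one]
    ring
  have h2 : det2 (framePoint θ (a, s)) (framePoint θ (a, s + ρ)) = ρ * a := by
    simp only [det2, framePoint_zero, framePoint_one]
    linear_combination ρ * a * Real.sin_sq_add_cos_sq θ
  rw [mem_lineStrip, h1, h2, abs_mul, abs_mul, abs_neg, mem_ofPred_eq]
  exact mul_le_mul_iff_right₀ (abs_pos.mpr hρ.ne')

/-- The chord, parametrized by arc length. -/
def chordParam (K : Set (EuclideanSpace ℝ (Fin 2))) (r θ : ℝ) : Set ℝ :=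
  {t | framePoint θ (r, t) ∈ K}

theorem isometry_framePoint (r θ : ℝ) : Isometry fun t : ℝ => framePoint θ (r, t) := by
  refine Isometry.of_dist_eq fun s t => ?_
  rw [EuclideanSpace.dist_eq, Real.dist_eq, ← Real.sqrt_sq_eq_abs]
  congr 1
  simp only [Fin.sum_univ_two, framePoint_zero, framePoint_one, Real.dist_eq, sq_abs]
  linear_combination (s - t) ^ 2 * Real.sin_sq_add_cos_sq θ

theorem eq_framePoint (z : EuclideanSpace ℝ (Fin 2)) (θ : ℝ) :
    z = framePoint θ (inner ℝ z (dirVec θ), inner ℝ z (tanVec θ)) := by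
  ext i
  fin_cases i <;>
    simp [framePoint_zero, framePoint_one, PiLp.inner_apply, Fin.sum_univ_two]
  · linear_combination (-z 0) * Real.sin_sq_add_cos_sq θ
  · linear_combination (-z 1) * Real.sin_sq_add_cos_sq θ

theorem chordLength_eq (K : Set (EuclideanSpace ℝ (Fin 2))) (r θ : ℝ) :
    chordLength K r θ = (volume (chordParam K r θ)).toReal := by
  rw [chordLength, ← hausdorffMeasure_real,
    ← (isometry_framePoint r θ).hausdorffMeasure_image (Or.inl zero_le_one)]
  congr 2
  ext z
  constructor
  · rintro ⟨hz, hzK⟩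
    have hz : inner ℝ z (dirVec θ) = r := hz
    refine ⟨inner ℝ z (tanVec θ), ?_, ?_⟩
    · rw [chordParam, mem_ofPred_eq, ← hz, ← eq_framePoint]
      exact hzK
    · simp only [← hz]
      exact (eq_framePoint z θ).symm
  · rintro ⟨t, ht, rfl⟩
    exact ⟨inner_framePoint θ (r, t), ht⟩

theorem isCompact_chordParam {K : Set (EuclideanSpace ℝ (Fin 2))} (hK : IsCompact K) (r θ : ℝ) :
    IsCompact (chordParam K r θ) :=
  (isometry_framePoint r θ).isClosedEmbedding.isCompact_preimage hK

theorem convex_chordParam {K : Set (EuclideanSpace ℝ (Fin 2))} (hK : Convex ℝ K) (r θ : ℝ) :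
    Convex ℝ (chordParam K r θ) := by
  intro s hs t ht a b ha hb hab
  have h := hK hs ht ha hb hab
  have : framePoint θ (r, a • s + b • t) =
      a • framePoint θ (r, s) + b • framePoint θ (r, t) := by
    have hr : r = a * r + b * r := by rw [← add_mul, hab, one_mul]
    simp only [framePoint, smul_add, smul_smul, smul_eq_mul, add_smul]
    conv_lhs => rw [hr, add_smul]
    abel
  rwa [chordParam, mem_ofPred_eq, this]

theorem lintegral_comp_abs (g : ℝ → ℝ≥0∞) : ∫⁻ a, g |a| = 2 * ∫⁻ a in Ioi (0 : ℝ), g a := by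
  have h1 : ∫⁻ a in Ioi (0 : ℝ), g |a| = ∫⁻ a in Ioi (0 : ℝ), g a :=
    setLIntegral_congr_fun measurableSet_Ioi fun a ha => by rw [abs_of_pos (mem_Ioi.mp ha)]
  have h2 : ∫⁻ a in (Ioi (0 : ℝ))ᶜ, g |a| = ∫⁻ a in Ioi (0 : ℝ), g a := by
    have h := (Measure.measurePreserving_neg (volume : Measure ℝ)).setLIntegral_comp_preimage_emb
      (MeasurableEquiv.neg ℝ).measurableEmbedding (fun a => g |a|) (Ioi 0)
    rw [← h1, ← h, compl_Ioi, setLIntegral_congr Iio_ae_eq_Iic.symm]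
    have : Neg.neg ⁻¹' Ioi (0 : ℝ) = Iio 0 := by ext; simp
    rw [this]
    simp only [abs_neg]
  rw [← lintegral_add_compl _ measurableSet_Ioi, h1, h2, two_mul]

/-- Moves the angle from the range of `polarCoord` to that of the theorem: both intervals are, up to
a null set, fundamental domains for the period. -/
theorem setLIntegral_Ioo_eq_of_periodic {h : ℝ → ℝ≥0∞} (hper : Function.Periodic h (2 * Real.pi)) :
    ∫⁻ θ in Ioo (-Real.pi) Real.pi, h θ = ∫⁻ θ in Ioc 0 (2 * Real.pi), h θ := by
  rw [setLIntegral_congr Ioo_ae_eq_Ioc]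
  have h1 := isAddFundamentalDomain_Ioc Real.two_pi_pos (-Real.pi)
  have h2 := isAddFundamentalDomain_Ioc Real.two_pi_pos 0
  rw [show -Real.pi + 2 * Real.pi = Real.pi by ring] at h1
  rw [zero_add] at h2
  refine h1.setLIntegral_eq h2 h ?_
  rintro ⟨g, hg⟩ x
  obtain ⟨k, rfl⟩ := AddSubgroup.mem_zmultiples_iff.mp hg
  change h (k • (2 * Real.pi) + x) = h x
  rw [add_comm]
  exact hper.zsmul k x

theorem chordLength_neg {K : Set (EuclideanSpace ℝ (Fin 2))} (hK : K = -K) (r θ : ℝ) :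
    chordLength K (-r) θ = chordLength K r θ := by
  have : chordParam K (-r) θ = Neg.neg ⁻¹' chordParam K r θ := by
    ext t
    have h : framePoint θ (-r, t) = -framePoint θ (r, -t) := by
      simp only [framePoint, neg_smul, neg_add, neg_neg]
    simp only [chordParam, mem_ofPred_eq, mem_preimage, h]
    conv_rhs => rw [hK, mem_neg]
  rw [chordLength_eq, chordLength_eq, this, Measure.measure_preimage_neg]

theorem chordLength_abs {K : Set (EuclideanSpace ℝ (Fin 2))} (hK : K = -K) (r θ : ℝ) :
    chordLength K |r| θ = chordLength K r θ := by
  rcases abs_choice r with h | h <;> rw [h]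
  exact chordLength_neg hK r θ

theorem isClosed_abs_inner_le : IsClosed {a : (ℝ × ℝ) × EuclideanSpace ℝ (Fin 2) |
    |inner ℝ a.2 (dirVec a.1.1)| ≤ a.1.2} :=
  isClosed_le (by fun_prop) (by fun_prop)

theorem restrict_abs_inner_le {K : Set (EuclideanSpace ℝ (Fin 2))} (hvol : volume K ≠ ∞)
    (r θ : ℝ) :
    volume.restrict K {z | |inner ℝ z (dirVec θ)| ≤ r} = ENNReal.ofReal (stripArea K r θ) := by
  have hm : MeasurableSet {z : EuclideanSpace ℝ (Fin 2) | |inner ℝ z (dirVec θ)| ≤ r} :=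
    (isClosed_le (by fun_prop) (by fun_prop)).measurableSet
  rw [Measure.restrict_apply hm, stripArea,
    ENNReal.ofReal_toReal (measure_ne_top_of_subset inter_subset_right hvol)]

theorem measurable_stripArea {K : Set (EuclideanSpace ℝ (Fin 2))} (hvol : volume K ≠ ∞) :
    Measurable fun q : ℝ × ℝ => stripArea K q.2 q.1 := by
  have h : Measurable fun q : ℝ × ℝ =>
      volume.restrict K {z | |inner ℝ z (dirVec q.1)| ≤ q.2} :=
    measurable_measure_prodMk_left isClosed_abs_inner_le.measurableSet
  simp only [restrict_abs_inner_le hvol] at h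
  have h' := h.ennreal_toReal
  simpa only [ENNReal.toReal_ofReal, stripArea, ENNReal.toReal_nonneg] using h'

theorem measurable_chordLength {K : Set (EuclideanSpace ℝ (Fin 2))} (hK : IsClosed K) :
    Measurable fun q : ℝ × ℝ => chordLength K q.2 q.1 := by
  have hc : IsClosed {a : (ℝ × ℝ) × ℝ | framePoint a.1.1 (a.1.2, a.2) ∈ K} :=
    hK.preimage (by fun_prop)
  have h : Measurable fun q : ℝ × ℝ => volume (chordParam K q.2 q.1) :=
    measurable_measure_prodMk_left hc.measurableSet
  simp only [chordLength_eq]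
  exact h.ennreal_toReal

/-! ### Assembling the formula. -/

/-- The integral over pairs of points of a function of the strip through them. -/
theorem lintegral_lintegral_lineStrip_pow {K : Set (EuclideanSpace ℝ (Fin 2))}
    (hK : IsSymmConvexBody K) (n : ℕ) :
    ∫⁻ p in K, ∫⁻ y in K, volume.restrict K (lineStrip p y) ^ n =
      ∫⁻ θ in Ioc 0 (2 * Real.pi), ∫⁻ r in Ioi (0 : ℝ),
        ENNReal.ofReal (stripArea K r θ ^ n * chordLength K r θ ^ 3 / 3) := by
  have hm : MeasurableSet K := hK.isCompact.measurableSet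
  have hvol : volume K ≠ ∞ := hK.isCompact.measure_ne_top
  set F : EuclideanSpace ℝ (Fin 2) × EuclideanSpace ℝ (Fin 2) → ℝ≥0∞ := fun a =>
    K.indicator 1 a.1 * K.indicator 1 a.2 * volume.restrict K (lineStrip a.1 a.2) ^ n with hFdef
  have hF : Measurable F :=
    (((measurable_one.indicator hm).comp measurable_fst).mul
      ((measurable_one.indicator hm).comp measurable_snd)).mul
      ((measurable_measure_lineStrip _).pow_const n)
  have hLHS : ∫⁻ p in K, ∫⁻ y in K, volume.restrict K (lineStrip p y) ^ n =
      ∫⁻ p, ∫⁻ y, F (p, y) := by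
    rw [← lintegral_indicator hm]
    refine lintegral_congr fun p => ?_
    by_cases hp : p ∈ K
    · rw [indicator_of_mem hp, ← lintegral_indicator hm]
      refine lintegral_congr fun y => ?_
      by_cases hy : y ∈ K <;> simp [hFdef, hp, hy]
    · simp [hFdef, hp]
  rw [hLHS, lintegral_lintegral_eq_lintegral_lines hF, ← setLIntegral_Ioo_eq_of_periodic]
  swap
  · intro θ
    have : dirVec (θ + 2 * Real.pi) = dirVec θ := by simp [dirVec]
    simp only [stripArea, chordLength, this]
  refine lintegral_congr fun θ => ?_
  -- The constant `1/6` of the chord integral is written as `2⁻¹` times `1/3`. The `2⁻¹` cancels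
  -- when the integral over `a` is folded onto `r > 0`.
  have hchord : ∀ a : ℝ, ∫⁻ s : ℝ, ∫⁻ ρ in Ioi (0 : ℝ), ENNReal.ofReal ρ *
      F (framePoint θ (a, s), framePoint θ (a, s + ρ)) =
      2⁻¹ * ENNReal.ofReal (stripArea K |a| θ ^ n * chordLength K |a| θ ^ 3 / 3) := by
    intro a
    have hA : 0 ≤ stripArea K |a| θ := ENNReal.toReal_nonneg
    calc ∫⁻ s : ℝ, ∫⁻ ρ in Ioi (0 : ℝ), ENNReal.ofReal ρ *
          F (framePoint θ (a, s), framePoint θ (a, s + ρ))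
        = ∫⁻ s : ℝ, ∫⁻ ρ in Ioi (0 : ℝ), ENNReal.ofReal (stripArea K |a| θ ^ n) *
            (ENNReal.ofReal ρ * ((chordParam K a θ).indicator 1 s *
              (chordParam K a θ).indicator 1 (s + ρ))) := by
          refine lintegral_congr fun s => setLIntegral_congr_fun measurableSet_Ioi fun ρ hρ => ?_
          simp only [hFdef]
          rw [lineStrip_framePoint θ a s hρ, restrict_abs_inner_le hvol, ENNReal.ofReal_pow hA,
            show K.indicator (1 : EuclideanSpace ℝ (Fin 2) → ℝ≥0∞) (framePoint θ (a, s)) =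
              (chordParam K a θ).indicator 1 s from rfl,
            show K.indicator (1 : EuclideanSpace ℝ (Fin 2) → ℝ≥0∞) (framePoint θ (a, s + ρ)) =
              (chordParam K a θ).indicator 1 (s + ρ) from rfl]
          ring
      _ = ENNReal.ofReal (stripArea K |a| θ ^ n) *
            ENNReal.ofReal (chordLength K |a| θ ^ 3 / 6) := by
          simp only [lintegral_const_mul' _ _ ENNReal.ofReal_ne_top]
          rw [lintegral_lintegral_indicator_mul_sub (isCompact_chordParam hK.isCompact a θ)
            (convex_chordParam hK.convex a θ), chordLength_abs hK.eq_neg, chordLength_eq]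
      _ = _ := by
          rw [← ENNReal.ofReal_mul (by positivity),
            show (2⁻¹ : ℝ≥0∞) = ENNReal.ofReal 2⁻¹ by
              rw [ENNReal.ofReal_inv_of_pos two_pos, ENNReal.ofReal_ofNat],
            ← ENNReal.ofReal_mul (by positivity)]
          congr 1
          ring
  simp only [hchord]
  rw [lintegral_const_mul' _ _ (by norm_num), lintegral_comp_abs (fun r =>
    ENNReal.ofReal (stripArea K r θ ^ n * chordLength K r θ ^ 3 / 3)), ← mul_assoc,
    ENNReal.inv_mul_cancel (by norm_num) (by norm_num), one_mul]

/-- The expected missed area, in terms of strips and chords. -/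
theorem lintegral_compl_convexHull_eq_prod {K : Set (EuclideanSpace ℝ (Fin 2))}
    (hK : IsSymmConvexBody K) (hvol : volume K = 1) (n : ℕ) :
    ∫⁻ x, volume.restrict K (convexHull ℝ (symPoints x))ᶜ
        ∂(Measure.pi fun _ : Fin (n + 1) => volume.restrict K) =
      ENNReal.ofReal ((n + 1 : ℕ) / 3) * ∫⁻ q in Ioc 0 (2 * Real.pi) ×ˢ Ioi (0 : ℝ),
        ENNReal.ofReal (stripArea K q.2 q.1 ^ n * chordLength K q.2 q.1 ^ 3) := by
  have hmeas : Measurable fun q : ℝ × ℝ =>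
      ENNReal.ofReal (stripArea K q.2 q.1 ^ n * chordLength K q.2 q.1 ^ 3) :=
    (((measurable_stripArea hK.isCompact.measure_ne_top).pow_const n).mul
      ((measurable_chordLength hK.isCompact.isClosed).pow_const 3)).ennreal_ofReal
  have hthird : ∀ c : ℝ, ENNReal.ofReal (c / 3) = ENNReal.ofReal (1 / 3) * ENNReal.ofReal c := by
    intro c
    rw [← ENNReal.ofReal_mul (by norm_num)]
    congr 1
    ring
  rw [(lintegral_measure_compl_convexHull hK.eq_neg hK.isCompact.measurableSet hvol n).2,
    lintegral_lintegral_lineStrip_pow hK n, Measure.volume_eq_prod, ← Measure.prod_restrict,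
    lintegral_prod _ hmeas.aemeasurable, hthird (n + 1 : ℕ), ENNReal.ofReal_natCast,
    mul_comm (ENNReal.ofReal (1 / 3)), mul_assoc]
  congr 1
  simp only [hthird (_ * _), lintegral_const_mul' _ _ ENNReal.ofReal_ne_top]

/-- Almost surely all points lie in `K`, and then convexity and symmetry keep the hull inside `K`,
where `volume.restrict K` measures its full area. -/
theorem symHullVolRatio_ae_eq {K : Set (EuclideanSpace ℝ (Fin 2))} (hK : IsSymmConvexBody K)
    (hvol : volume K = 1) (N : ℕ) :
    (fun x => symHullVolRatio K x) =ᵐ[Measure.pi fun _ : Fin N => volume.restrict K]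
      fun x => 1 - (volume.restrict K (convexHull ℝ (symPoints x))ᶜ).toReal := by
  have hprob : IsProbabilityMeasure (volume.restrict K) := ⟨by simpa using hvol⟩
  have hmem : ∀ᵐ x ∂(Measure.pi fun _ : Fin N => volume.restrict K), x ∈ univ.pi fun _ => K := by
    rw [← Measure.restrict_pi_pi]
    exact ae_restrict_mem (MeasurableSet.univ_pi fun _ => hK.isCompact.measurableSet)
  filter_upwards [hmem] with x hx
  have hsub : convexHull ℝ (symPoints x) ⊆ K := by
    refine convexHull_min ?_ hK.convex
    rintro z (⟨i, rfl⟩ | ⟨i, rfl⟩)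
    · exact hx i trivial
    · rw [hK.eq_neg, mem_neg, neg_neg]
      exact hx i trivial
  have hc := (isClosed_convexHull_symPoints x).measurableSet
  have h := probReal_compl_eq_one_sub (μ := volume.restrict K) hc
  simp only [measureReal_def] at h
  rw [h, sub_sub_cancel, Measure.restrict_apply hc, inter_eq_left.mpr hsub, symHullVolRatio, hvol,
    ENNReal.toReal_one, div_one]
  rfl

theorem mainTheorem4 (K : Set (EuclideanSpace ℝ (Fin 2))) (hK : IsSymmConvexBody K)
    (hvol : MeasureTheory.volume K = 1) (N : ℕ) (hN : 2 ≤ N)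
    {Ω : Type*} [MeasurableSpace Ω] (P : MeasureTheory.Measure Ω)
    [MeasureTheory.IsProbabilityMeasure P]
    (X : Fin N → Ω → EuclideanSpace ℝ (Fin 2)) (hX : ∀ i, Measurable (X i))
    (hindep : ProbabilityTheory.iIndepFun X P)
    (hunif : ∀ i, MeasureTheory.pdf.IsUniform (X i) K P MeasureTheory.volume) :
    MeasureTheory.Integrable (fun ω => symHullVolRatio K (fun i => X i ω)) P ∧
    MeasureTheory.IntegrableOn
      (fun q : ℝ × ℝ => stripArea K q.2 q.1 ^ (N - 1) * chordLength K q.2 q.1 ^ 3)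
      (Set.Ioc 0 (2 * Real.pi) ×ˢ Set.Ioi 0) MeasureTheory.volume ∧
    ∫ ω, symHullVolRatio K (fun i => X i ω) ∂P =
      1 - (N : ℝ) / 3 * ∫ θ in (0 : ℝ)..(2 * Real.pi), ∫ r in Set.Ioi (0 : ℝ),
        stripArea K r θ ^ (N - 1) * chordLength K r θ ^ 3 := by
  obtain ⟨n, rfl⟩ : ∃ n, N = n + 1 := ⟨N - 1, by omega⟩
  rw [Nat.add_sub_cancel]
  have hprob : IsProbabilityMeasure (volume.restrict K) := ⟨by simpa using hvol⟩
  have hXm : Measurable fun ω i => X i ω := measurable_pi_lambda _ hX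
  have hmap : P.map (fun ω i => X i ω) = Measure.pi fun _ : Fin (n + 1) => volume.restrict K := by
    rw [(ProbabilityTheory.iIndepFun_iff_map_fun_eq_pi_map fun i => (hX i).aemeasurable).mp hindep]
    congr 1
    ext1 i
    rw [hunif i, ProbabilityTheory.cond, hvol, inv_one, one_smul]
  have hae := (lintegral_measure_compl_convexHull hK.eq_neg hK.isCompact.measurableSet hvol n).1
  have hprod := lintegral_compl_convexHull_eq_prod hK hvol n
  have hV := symHullVolRatio_ae_eq hK hvol (n + 1)
  have hle : ∀ x : Fin (n + 1) → EuclideanSpace ℝ (Fin 2),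
      volume.restrict K (convexHull ℝ (symPoints x))ᶜ ≤ 1 := fun x => prob_le_one
  have hlt : ∫⁻ x, volume.restrict K (convexHull ℝ (symPoints x))ᶜ
      ∂(Measure.pi fun _ : Fin (n + 1) => volume.restrict K) ≠ ∞ := by
    refine ((lintegral_mono hle).trans_lt ?_).ne
    simp
  have hint : Integrable (fun x => (volume.restrict K (convexHull ℝ (symPoints x))ᶜ).toReal)
      (Measure.pi fun _ : Fin (n + 1) => volume.restrict K) :=
    integrable_toReal_of_lintegral_ne_top hae hlt
  have hVint : Integrable (fun x => symHullVolRatio K x)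
      (Measure.pi fun _ : Fin (n + 1) => volume.restrict K) :=
    ((integrable_const 1).sub hint).congr hV.symm
  have hmeas : Measurable fun q : ℝ × ℝ => stripArea K q.2 q.1 ^ n * chordLength K q.2 q.1 ^ 3 :=
    ((measurable_stripArea hK.isCompact.measure_ne_top).pow_const n).mul
      ((measurable_chordLength hK.isCompact.isClosed).pow_const 3)
  have hnn : ∀ q : ℝ × ℝ, 0 ≤ stripArea K q.2 q.1 ^ n * chordLength K q.2 q.1 ^ 3 := fun q =>
    mul_nonneg (pow_nonneg ENNReal.toReal_nonneg _) (pow_nonneg ENNReal.toReal_nonneg _)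
  have hc : ENNReal.ofReal ((n + 1 : ℕ) / 3) ≠ 0 := by
    rw [Ne, ENNReal.ofReal_eq_zero, not_le]
    positivity
  -- Finiteness comes from the identity itself: the expected missed area is at most 1 and the
  -- constant in front of the integral is nonzero.
  have hJ : ∫⁻ q in Ioc 0 (2 * Real.pi) ×ˢ Ioi (0 : ℝ),
      ENNReal.ofReal (stripArea K q.2 q.1 ^ n * chordLength K q.2 q.1 ^ 3) ≠ ∞ := by
    intro h
    rw [h, ENNReal.mul_top hc] at hprod
    exact hlt hprod
  have hI : IntegrableOn (fun q : ℝ × ℝ => stripArea K q.2 q.1 ^ n * chordLength K q.2 q.1 ^ 3)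
      (Ioc 0 (2 * Real.pi) ×ˢ Ioi 0) volume :=
    (lintegral_ofReal_ne_top_iff_integrable hmeas.aestronglyMeasurable
      (Filter.Eventually.of_forall hnn)).mp hJ
  refine ⟨?_, hI, ?_⟩
  · exact Integrable.comp_measurable (hmap ▸ hVint) hXm
  · have h1 : ∫ ω, symHullVolRatio K (fun i => X i ω) ∂P =
        ∫ x, symHullVolRatio K x ∂(Measure.pi fun _ : Fin (n + 1) => volume.restrict K) := by
      rw [← hmap, integral_map hXm.aemeasurable (hmap ▸ hVint.aestronglyMeasurable)]
    rw [h1, integral_congr_ae hV, integral_sub (integrable_const 1) hint,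
      integral_toReal hae (Filter.Eventually.of_forall fun x => (hle x).trans_lt ENNReal.one_lt_top),
      hprod, ENNReal.toReal_mul, ENNReal.toReal_ofReal (by positivity),
      ← integral_eq_lintegral_of_nonneg_ae (Filter.Eventually.of_forall hnn)
        hmeas.aestronglyMeasurable,
      intervalIntegral.integral_of_le Real.two_pi_pos.le]
    rw [Measure.volume_eq_prod] at hI ⊢
    rw [setIntegral_prod _ hI]
    simp
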